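/- Let $\|\cdot\|$ be the Euclidean norm on $\mathbb{R}^n$ (and the induced operator norm). Let $f:\mathbb{R}^n\to\mathbb{R}^n$ be $C^2$, $f(x^*)=0$, and $f''(x)-f''(x^*)=O(\|x-x^*\|)$ as $x\to x^*$. Let $N=\ker f'(x^*)=\operatorname{span}\{v^*\}$ with $\|v^*\|=1$, let $R$ be the range of $f'(x^*)$, and assume $\mathbb{R}^n=N\oplus R$; let $P_N,P_R$ be the projections belonging to this decomposition (the orthogonal projections when $R=N^\perp$). Assume that $f$ is 2-regular at $x^*$ along $v^*$: the operator $f'(x^*)+P_Nf''(x^*)(v^*,P_N\,\cdot)$ is invertible as a map from $N$ to $N$. For $\varepsilon,\delta>0$ put $$\hat W(\varepsilon,\delta)=\Big\{x\neq x^*:\ \|x-x^*\|<\varepsilon,\ \Big\|\tfrac{x-x^*}{\|x-x^*\|}-v^*\Big\|<\delta\Big\}.$$ Let $\Omega_j:\mathbb{R}^n\to\mathbb{R}^{n\times n}$, $\omega_j:\mathbb{R}^n\to\mathbb{R}^n$ ($j\in I$) be a family of perturbation maps such that, uniformly in $j$, as $x\to x^*$, $x\ne x^*$, $$\Omega_j(x)=O(\|x-x^*\|),\qquad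 P_N\Omega_j(x)=O(\|P_R(x-x^*)\|)+O(\|x-x^*\|^2),$$ $$\omega_j(x)=O(\|x-x^*\|^2),\qquad P_N\omega_j(x)=O(\|x-x^*\|\,\|P_R(x-x^*)\|)+O(\|x-x^*\|^3),$$ and such that for every $\Delta>0$ there are $\varepsilon,\delta>0$ with $\|P_N\Omega_j(x)\|\le\Delta\|x-x^*\|$ for all $x\in\hat W(\varepsilon,\delta)$ and all $j$. Fix $r\in(0,1)$. Given $x_0$ and indices $j_0,j_1,\dots\in I$, the adaptive $\gamma$-safeguarded perturbed Newton method is the following iteration. For $k\ge0$, $w_{k+1}$ is the solution $d$ of $[f'(x_k)+\Omega_{j_k}(x_k)]\,d=-f(x_k)+\omega_{j_k}(x_k)$. Set $x_1=x_0+w_1$, and for $k\ge1$ $$x_{k+1}=x_k+w_{k+1}-\lambda_{k+1}\gamma_{k+1}(x_k-x_{k-1}+w_{k+1}-w_k),\qquad \gamma_{k+1}=\frac{(w_{k+1}-w_k)^Tw_{k+1}}{\|w_{k+1}-w_k\|^2},$$ where, with $\eta_{k+1}=\|w_{k+1}\|/\|w_k\|$ and $\beta_{k+1}=\min\{\eta_{k+1},r\}\,\eta_{k+1}$: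 $\lambda_{k+1}=0$ if $\gamma_{k+1}=0$ or $\gamma_{k+1}\ge1$; otherwise $\lambda_{k+1}=\dfrac{\beta_{k+1}}{\gamma_{k+1}(\beta_{k+1}+\operatorname{sign}\gamma_{k+1})}$ if $|\gamma_{k+1}|/|1-\gamma_{k+1}|>\beta_{k+1}$, and $\lambda_{k+1}=1$ otherwise. Let $$\theta_{k+1}=\frac{\|w_{k+1}-\lambda_{k+1}\gamma_{k+1}(w_{k+1}-w_k)\|}{\|w_{k+1}\|}$$ be the optimization gain of the (safeguarded) step, and $e_k=x_k-x^*$. Then there are $C>0$, $\kappa\in(0,1)$ and $\delta_0>0$ such that for every $\delta\in(0,\delta_0)$ there is $\varepsilon_0>0$ such that for every $\varepsilon\in(0,\varepsilon_0)$, every $x_0\in\hat W=\hat W(\varepsilon,\delta)$ and every choice of indices $j_k\in I$: the method is well defined (all matrices $f'(x_k)+\Omega_{j_k}(x_k)$ are invertible, and $w_k\neq0$, $w_{k+1}\ne w_k$ for $k\ge1$), all $x_k$ lie in $\hat W$, $x_k\to x^*$, and for all $k\ge1$ $$\|P_Re_{k+1}\|\le C\max\{\|e_k\|^2,\|e_{k-1}\|^2\},\qquad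 \|P_Ne_{k+1}\|\le\kappa\,\theta_{k+1}\,\|P_Ne_k\|.$$ -/

import Mathlib

open Filter Topology Asymptotics

noncomputable section

/-- Euclidean space `ℝⁿ` with the Euclidean norm. -/
abbrev Eu (n : ℕ) : Type := EuclideanSpace ℝ (Fin n)

/-- The null space `N` of the derivative `f'(x)`. -/
def nullSp {n : ℕ} (f : Eu n → Eu n) (x : Eu n) : Submodule ℝ (Eu n) :=
  LinearMap.ker (fderiv ℝ f x : Eu n →ₗ[ℝ] Eu n)

/-- The range space `R` of the derivative `f'(x)`. -/
def rangeSp {n : ℕ} (f : Eu n → Eu n) (x : Eu n) : Submodule ℝ (Eu n) :=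
  LinearMap.range (fderiv ℝ f x : Eu n →ₗ[ℝ] Eu n)

/-- Given `ℝⁿ = p ⊕ q`, the projection onto `p` along `q`. For `q = pᗮ` this is the orthogonal
projection onto `p`. -/
def projAlong {n : ℕ} (p q : Submodule ℝ (Eu n)) (h : IsCompl p q) : Eu n →L[ℝ] Eu n :=
  LinearMap.toContinuousLinearMap (p.projection q h)

/-- The second derivative `f''(x)`, as a bilinear map `f''(x) u v`. -/
def secondDeriv {n : ℕ} (f : Eu n → Eu n) (x : Eu n) : Eu n →L[ℝ] Eu n →L[ℝ] Eu n :=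
  fderiv ℝ (fderiv ℝ f) x

/-- 2-regularity of `f` at `x` along `v`: the operator `f'(x) + P_N f''(x)(v, P_N ·)` is
invertible as a map from `N` to `N`; here `N ⊕ R = ℝⁿ` are the null space and the range of
`f'(x)`, and `P_N` is the projection onto `N` along `R`. -/
def TwoRegularAt {n : ℕ} (f : Eu n → Eu n) (x v : Eu n)
    (h : IsCompl (nullSp f x) (rangeSp f x)) : Prop :=
  Set.BijOn
    (fun u : Eu n => fderiv ℝ f x u +
      projAlong (nullSp f x) (rangeSp f x) h
        (secondDeriv f x v (projAlong (nullSp f x) (rangeSp f x) h u)))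
    (nullSp f x) (nullSp f x)

/-- The starlike domain with vertex `xs`, axis `v`, radius `ε` and angular aperture `δ`
(without its vertex, where the direction of `x - xs` is undefined). -/
def starlikeDomain {n : ℕ} (xs v : Eu n) (ε δ : ℝ) : Set (Eu n) :=
  {x | x ≠ xs ∧ ‖x - xs‖ < ε ∧ ‖‖x - xs‖⁻¹ • (x - xs) - v‖ < δ}

/-- The estimates on the perturbation terms as `x → xs`. The perturbations form a family
`(Ω j, ω j)`, `j : ι`, and the estimates are uniform in `j` (this is the role of `⊤ ×ˢ _`).
Operators are measured in the operator norm. -/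
structure PerturbationEstimates {n : ℕ} {ι : Type*} (xs v : Eu n) (PN PR : Eu n →L[ℝ] Eu n)
    (Ω : ι → Eu n → (Eu n →L[ℝ] Eu n)) (ω : ι → Eu n → Eu n) : Prop where
  /-- `Ω(x) = O(‖x - x*‖)` -/
  Omega_bigO : (fun p : ι × Eu n => Ω p.1 p.2)
    =O[⊤ ×ˢ 𝓝[≠] xs] (fun p : ι × Eu n => ‖p.2 - xs‖)
  /-- `‖P_N Ω(x)‖ ≤ Δ ‖x - x*‖` on a starlike domain depending on `Δ` -/
  PN_Omega_small : ∀ Δ > (0 : ℝ), ∃ ε > (0 : ℝ), ∃ δ > (0 : ℝ),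
    ∀ j, ∀ x ∈ starlikeDomain xs v ε δ, ‖PN ∘L Ω j x‖ ≤ Δ * ‖x - xs‖
  /-- `ω(x) = O(‖x - x*‖²)` -/
  omega_bigO : (fun p : ι × Eu n => ω p.1 p.2)
    =O[⊤ ×ˢ 𝓝[≠] xs] (fun p : ι × Eu n => ‖p.2 - xs‖ ^ 2)
  /-- `P_N Ω(x) = O(‖P_R (x - x*)‖) + O(‖x - x*‖²)` -/
  PN_Omega_bigO : (fun p : ι × Eu n => PN ∘L Ω p.1 p.2)
    =O[⊤ ×ˢ 𝓝[≠] xs] (fun p : ι × Eu n => ‖PR (p.2 - xs)‖ + ‖p.2 - xs‖ ^ 2)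
  /-- `P_N ω(x) = O(‖x - x*‖ ‖P_R (x - x*)‖) + O(‖x - x*‖³)` -/
  PN_omega_bigO : (fun p : ι × Eu n => PN (ω p.1 p.2))
    =O[⊤ ×ˢ 𝓝[≠] xs]
      (fun p : ι × Eu n => ‖p.2 - xs‖ * ‖PR (p.2 - xs)‖ + ‖p.2 - xs‖ ^ 3)

/-- The depth-one Anderson coefficient `γ_{k+1}`, from `w' = w_{k+1}` and `w = w_k`: the minimizer
of `‖w' - γ (w' - w)‖` over real `γ`, if `w' ≠ w`. -/
def andersonCoeff {n : ℕ} (w' w : Eu n) : ℝ :=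
  inner ℝ (w' - w) w' / ‖w' - w‖ ^ 2

/-- Adaptive `γ`-safeguarding with inputs `γ = γ_{k+1}`, `w' = w_{k+1}`, `w = w_k` and `r`;
returns the scaling factor `λ_{k+1}`. -/
def adaptiveSafeguard {n : ℕ} (γ : ℝ) (w' w : Eu n) (r : ℝ) : ℝ :=
  let η : ℝ := ‖w'‖ / ‖w‖
  let β : ℝ := min η r * η
  if γ = 0 ∨ 1 ≤ γ then 0
  else if β < |γ| / |1 - γ| then β / (γ * (β + Real.sign γ))
  else 1

/-- The safeguarded coefficient `λ_{k+1} γ_{k+1}`. -/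
def safeguardedCoeff {n : ℕ} (r : ℝ) (w' w : Eu n) : ℝ :=
  adaptiveSafeguard (andersonCoeff w' w) w' w r * andersonCoeff w' w

/-- The gain `‖w' - c (w' - w)‖ / ‖w'‖` of a depth-one Anderson step with coefficient `c`. -/
def gain {n : ℕ} (c : ℝ) (w' w : Eu n) : ℝ :=
  ‖w' - c • (w' - w)‖ / ‖w'‖

/-- `x` and `w` are the iterates and update steps of the adaptive `γ`-safeguarded perturbed Newton
method with parameter `r`, where step `k` uses the perturbation terms `Ω_k = Ω (i k) (x k)` and
`ω_k = ω (i k) (x k)`. The value `w 0` is not used. -/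
structure IsSafeguardedPNM {n : ℕ} {ι : Type*} (f : Eu n → Eu n)
    (Ω : ι → Eu n → (Eu n →L[ℝ] Eu n)) (ω : ι → Eu n → Eu n) (r : ℝ) (i : ℕ → ι)
    (x w : ℕ → Eu n) : Prop where
  /-- `w_{k+1}` solves `(f'(x_k) + Ω_k) d = -f(x_k) + ω_k` (when the operator is invertible) -/
  update : ∀ k, w (k + 1) =
    (fderiv ℝ f (x k) + Ω (i k) (x k)).inverse (-f (x k) + ω (i k) (x k))
  first : x 1 = x 0 + w 1
  step : ∀ k, 1 ≤ k → x (k + 1) = x k + w (k + 1) -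
    safeguardedCoeff r (w (k + 1)) (w k) • (x k - x (k - 1) + w (k + 1) - w k)

end

/-!
Write `e = x - xs`, let `P`, `Q` be the projections onto `N = ℝ v` and onto the range of `f'(xs)`,
and let `t = ‖e‖`.

*One Newton step.* On a starlike domain around the axis `v`, the operator `f'(x) + Ω` is a
perturbation `A + S` of the singular operator `A = f'(xs)` with `S` of size `t`. It is invertible
because `A` is bounded below on its range and, by 2-regularity, `P S` acts on the kernel as a nonzero
multiple of `t` up to `o(t)` (`singular_perturbation_bounds`). By Taylor expansion `(t / 2) v` solves the
equation for `e + w` up to a residual that is `O(t ^ 2)`, and `o(t ^ 2)` in the `P` component as the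
domain shrinks (`residual_bounds`). Hence the Newton image satisfies `e + w = (t / 2) v + o(t)` and
`Q (e + w) = O(t ^ 2)`, so that `w = -(t / 2) v + o(t)` (`newton_estimate`).

*One Anderson step.* With the safeguarded coefficient `c`, the new error is
`(1 - c) (e_k + w_{k+1}) + c (e_{k-1} + w_k)`. The error reduction makes the steps `w` decrease in
norm, and then the safeguard gives `c < 1` together with `|c| ‖w_k‖ ≤ r (1 - c) ‖w_{k+1}‖` and
`|c| ‖w_k‖ ^ 2 ≤ (1 - c) ‖w_{k+1}‖ ^ 2` (`safeguardedCoeff_bounds`). The first inequality, with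
`r < 1`, keeps the combined step `(1 - c) w_{k+1} + c w_k` comparable to `(1 - c) t_k`; as all
errors are small relative to `(1 - c) t_k`, the new error is nearly minus the combined step, whose
norm is the gain times `‖w_{k+1}‖ ≈ t_k / 2`. The second inequality bounds the `Q` component by a
multiple of `(1 - c) t_k ^ 2` (`anderson_step`).

*Invariance.* The new error thus has a positive coordinate along `v` of order at least
`(1 - c) t_k`, and a `Q` component smaller by a factor `O(t_k)`. If `ε` is small compared with `δ`,
it lies in the same cone (`anderson_step_mem_cone`). Since the gain is at most `1`, the norm of the
error contracts by `3 / 4`, and the argument can be repeated from the new iterate.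
-/

/-! ### The adaptive safeguard -/

/-- If the steps do not increase, the safeguarded coefficient `c` lies between `0` and the
minimizer `γ`, which bounds the gain, and satisfies `|c| ≤ β (1 - c)` for `β = min {η, r} η`; the
bounds on `|c|` follow from `β ≤ r`, `β ≤ r η` and `β ≤ η ^ 2`. -/
lemma safeguardedCoeff_bounds {n : ℕ} {r : ℝ} (hr : r ∈ Set.Ioo (0 : ℝ) 1) {w' w : Eu n}
    (hw : 0 < ‖w‖) (hle : ‖w'‖ ≤ ‖w‖) :
    let c := safeguardedCoeff r w' w
    0 < 1 - c ∧ |c| ≤ r * (1 - c) ∧ |c| * ‖w‖ ≤ r * (1 - c) * ‖w'‖ ∧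
      |c| * ‖w‖ ^ 2 ≤ (1 - c) * ‖w'‖ ^ 2 ∧ gain c w' w ≤ 1 := by
  obtain ⟨hr0, hr1⟩ := hr
  intro c
  set γ := andersonCoeff w' w with hγ
  set l := adaptiveSafeguard γ w' w r with hl
  have hc : c = l * γ := rfl
  set η := ‖w'‖ / ‖w‖ with hη
  set β := min η r * η with hβ
  have hη0 : 0 ≤ η := by positivity
  have hη1 : η ≤ 1 := div_le_one_of_le₀ hle hw.le
  have hw' : ‖w'‖ = η * ‖w‖ := by rw [hη]; field_simp
  have hβ0 : 0 ≤ β := mul_nonneg (le_min hη0 hr0.le) hη0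
  have hβr : β ≤ r * η := mul_le_mul_of_nonneg_right (min_le_right _ _) hη0
  have hβη : β ≤ η * η := mul_le_mul_of_nonneg_right (min_le_left _ _) hη0
  have hβ1 : β < 1 := by nlinarith
  -- `c` lies between `0` and `γ`, and `|c| / (1 - c) ≤ β`
  have key : 0 < 1 - c ∧ |c| ≤ β * (1 - c) ∧ 0 ≤ l ∧ l ≤ 1 := by
    have hl' : l = if γ = 0 ∨ 1 ≤ γ then 0
      else if β < |γ| / |1 - γ| then β / (γ * (β + Real.sign γ)) else 1 := rfl
    split_ifs at hl' with h1 h2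
    · rw [hc, hl']; simp [hβ0]
    · push Not at h1
      obtain ⟨h0, h1⟩ := h1
      have hg : 0 < 1 - γ := by linarith
      rw [abs_of_pos hg, lt_div_iff₀ hg] at h2
      rcases lt_or_gt_of_ne h0 with hneg | hpos
      · rw [Real.sign_of_neg hneg] at hl'
        rw [abs_of_neg hneg] at h2
        have hb : 0 < 1 - β := by linarith
        have hb' : β + -1 ≠ 0 := by linarith
        have e1 : c = -(β / (1 - β)) := by
          rw [hc, hl']; field_simp; ring
        have e2 : 1 - c = 1 / (1 - β) := by rw [e1]; field_simp; ring
        have e3 : l = β / (-γ * (1 - β)) := by rw [hl']; congr 1; ring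
        refine ⟨by rw [e2]; positivity, ?_, ?_, ?_⟩
        · rw [e2, e1, abs_neg, abs_of_nonneg (by positivity)]; apply le_of_eq; ring
        · have : 0 < -γ := by linarith
          rw [e3]; positivity
        · have : 0 < -γ := by linarith
          rw [e3, div_le_one (by positivity)]; nlinarith
      · rw [Real.sign_of_pos hpos] at hl'
        rw [abs_of_pos hpos] at h2
        have e1 : c = β / (β + 1) := by
          rw [hc, hl']; field_simp
        have e2 : 1 - c = 1 / (β + 1) := by rw [e1]; field_simp; ring
        refine ⟨by rw [e2]; positivity, ?_, ?_, ?_⟩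
        · rw [e2, e1, abs_of_nonneg (by positivity)]; apply le_of_eq; ring
        · rw [hl']; positivity
        · rw [hl', div_le_one (by positivity)]; nlinarith
    · push Not at h1 h2
      obtain ⟨h0, h1⟩ := h1
      have hg : 0 < 1 - γ := by linarith
      rw [abs_of_pos hg, div_le_iff₀ hg] at h2
      rw [hc, hl', one_mul]
      exact ⟨hg, h2, zero_le_one, le_rfl⟩
  obtain ⟨k1, k2, k3, k4⟩ := key
  refine ⟨k1, ?_, ?_, ?_, ?_⟩
  · exact k2.trans (mul_le_mul_of_nonneg_right (by nlinarith) k1.le)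
  · calc |c| * ‖w‖ ≤ β * (1 - c) * ‖w‖ := by gcongr
      _ ≤ r * η * (1 - c) * ‖w‖ := by gcongr
      _ = r * (1 - c) * ‖w'‖ := by rw [hw']; ring
  · calc |c| * ‖w‖ ^ 2 ≤ β * (1 - c) * ‖w‖ ^ 2 := by gcongr
      _ ≤ η * η * (1 - c) * ‖w‖ ^ 2 := by gcongr
      _ = (1 - c) * ‖w'‖ ^ 2 := by rw [hw']; ring
  · apply div_le_one_of_le₀ _ (norm_nonneg _)
    by_cases hd : w' - w = 0
    · simp [hd]
    have hd' : 0 < ‖w' - w‖ := norm_pos_iff.2 hd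
    have hin : inner ℝ w' (w' - w) = γ * ‖w' - w‖ ^ 2 := by
      rw [hγ, andersonCoeff, real_inner_comm]; field_simp
    apply le_of_sq_le_sq _ (norm_nonneg _)
    rw [norm_sub_sq_real, inner_smul_right, hin, norm_smul, mul_pow, Real.norm_eq_abs, sq_abs, hc]
    have : 0 ≤ l * (2 - l) * (γ ^ 2 * ‖w' - w‖ ^ 2) :=
      mul_nonneg (mul_nonneg k3 (by linarith)) (by positivity)
    nlinarith

/-! ### Taylor estimates at the root -/

/-- Second order Taylor estimates, with cubic remainder since `f''` is Lipschitz at `xs`. -/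
lemma taylor_bounds {n : ℕ} {f : Eu n → Eu n} {xs : Eu n} (hC2 : ContDiff ℝ 2 f)
    (hLip : (fun x => secondDeriv f x - secondDeriv f xs) =O[𝓝 xs] (fun x => ‖x - xs‖)) :
    ∃ K > (0 : ℝ), ∃ ρ > (0 : ℝ), ∀ x, ‖x - xs‖ < ρ →
      ‖fderiv ℝ f x - fderiv ℝ f xs - secondDeriv f xs (x - xs)‖ ≤ K * ‖x - xs‖ ^ 2 ∧
      ‖f x - f xs - fderiv ℝ f xs (x - xs) - (1 / 2 : ℝ) • secondDeriv f xs (x - xs) (x - xs)‖ ≤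
        K * ‖x - xs‖ ^ 3 := by
  obtain ⟨K, hK, hb⟩ := hLip.exists_pos
  rw [isBigOWith_iff, Metric.eventually_nhds_iff] at hb
  obtain ⟨ρ, hρ, hb⟩ := hb
  set B := secondDeriv f xs
  have hf : Differentiable ℝ f := hC2.differentiable (by norm_num)
  have hf' : Differentiable ℝ (fderiv ℝ f) :=
    (hC2.fderiv_right (m := 1) (by norm_num)).differentiable (by norm_num)
  have hsymm : ∀ a b, B a b = B b a := by
    have : IsSymmSndFDerivAt ℝ f xs := hC2.contDiffAt.isSymmSndFDerivAt (by simp)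
    exact fun a b => this a b
  have h1 : ∀ x, ‖x - xs‖ < ρ →
      ‖fderiv ℝ f x - fderiv ℝ f xs - B (x - xs)‖ ≤ K * ‖x - xs‖ ^ 2 := by
    intro x hx
    have hder : ∀ y ∈ Metric.closedBall xs ‖x - xs‖,
        HasFDerivWithinAt (fun y => fderiv ℝ f y - B (y - xs)) (secondDeriv f y - B)
          (Metric.closedBall xs ‖x - xs‖) y := fun y _ =>
      ((hf' y).hasFDerivAt.sub
        (B.hasFDerivAt.comp y ((hasFDerivAt_id y).sub_const xs))).hasFDerivWithinAt
    have := (convex_closedBall xs ‖x - xs‖).norm_image_sub_le_of_norm_hasFDerivWithin_le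
      (C := K * ‖x - xs‖) hder (fun y hy => by
        rw [mem_closedBall_iff_norm] at hy
        have := hb (y := y) (by rw [dist_eq_norm]; linarith)
        rw [norm_norm] at this
        exact this.trans (by gcongr))
      (Metric.mem_closedBall_self (norm_nonneg _)) (by simp [dist_eq_norm] : x ∈ _)
    calc _ = ‖fderiv ℝ f x - B (x - xs) - (fderiv ℝ f xs - B (xs - xs))‖ := by
          congr 1; simp; abel
      _ ≤ _ := this
      _ = _ := by ring
  refine ⟨K, hK, ρ, hρ, fun x hx => ⟨h1 x hx, ?_⟩⟩
  have hder : ∀ y ∈ Metric.closedBall xs ‖x - xs‖,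
      HasFDerivWithinAt
        (fun y => f y - fderiv ℝ f xs (y - xs) - (1 / 2 : ℝ) • B (y - xs) (y - xs))
        (fderiv ℝ f y - fderiv ℝ f xs - B (y - xs)) (Metric.closedBall xs ‖x - xs‖) y := by
    intro y _
    have hid := (hasFDerivAt_id (𝕜 := ℝ) y).sub_const xs
    have hq := ((B.hasFDerivAt.comp y hid).clm_apply hid).const_smul (1 / 2 : ℝ)
    have := (((hf y).hasFDerivAt.sub ((fderiv ℝ f xs).hasFDerivAt.comp y hid)).sub hq)
    refine (this.congr_fderiv ?_).hasFDerivWithinAt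
    ext1 z
    simp only [_root_.sub_apply, ContinuousLinearMap.comp_apply,
      _root_.smul_apply, _root_.add_apply,
      ContinuousLinearMap.flip_apply, ContinuousLinearMap.id_apply, id, Function.comp]
    rw [hsymm z (y - xs)]
    module
  have := (convex_closedBall xs ‖x - xs‖).norm_image_sub_le_of_norm_hasFDerivWithin_le
      (C := K * ‖x - xs‖ ^ 2) hder (fun y hy => by
        rw [mem_closedBall_iff_norm] at hy
        exact (h1 y (by linarith)).trans (by gcongr))
      (Metric.mem_closedBall_self (norm_nonneg _)) (by simp [dist_eq_norm] : x ∈ _)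
  calc _ = ‖(f x - fderiv ℝ f xs (x - xs) - (1 / 2 : ℝ) • B (x - xs) (x - xs)) -
        (f xs - fderiv ℝ f xs (xs - xs) - (1 / 2 : ℝ) • B (xs - xs) (xs - xs))‖ := by
          congr 1; simp; abel
    _ ≤ _ := this
    _ = _ := by ring

/-! ### Perturbations of an operator with one-dimensional kernel -/

/-- `P + Q = 1` is a splitting of the space in which `P` has values in the line `ℝ v` and `Q`
vanishes on it. -/
structure LineSplitting {n : ℕ} (P Q : Eu n →L[ℝ] Eu n) (v : Eu n) : Prop where
  norm_eq_one : ‖v‖ = 1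
  add_apply : ∀ y, P y + Q y = y
  exists_smul : ∀ y, ∃ α : ℝ, P y = α • v
  right_apply : Q v = 0

lemma LineSplitting.left_apply {n : ℕ} {P Q : Eu n →L[ℝ] Eu n} {v : Eu n}
    (h : LineSplitting P Q v) : P v = v := by
  simpa [h.right_apply] using h.add_apply v

/-- A priori bounds for `A + S`, where `A` is singular with kernel `ℝ v` and `S` is of size `t`:
the component along `v` is only controlled with the factor `1 / t`, and the scalar `c` measures the
action of `S` on the kernel. -/
lemma singular_perturbation_bounds {n : ℕ} {P Q A S : Eu n →L[ℝ] Eu n} {v : Eu n}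
    (h : LineSplitting P Q v) {L m t c : ℝ} (hL : 0 ≤ L) (hc : c ≠ 0) (ht : 0 < t)
    (hP : ∀ y, ‖P y‖ ≤ L * ‖y‖) (hQ : ∀ y, ‖Q y‖ ≤ L * ‖y‖)
    (hPA : ∀ y, P (A y) = 0) (hm : ∀ y, m * ‖Q y‖ ≤ ‖A y‖)
    (hS : ∀ y, ‖S y‖ ≤ L * t * ‖y‖) (hSv : ‖P (S v) - (t * c) • v‖ ≤ |c| / 2 * t)
    (hsmall : L * L * t * (1 + 2 * L * L / |c|) ≤ m / 2) (y : Eu n) :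
    t * (|c| / 2) * ‖P y‖ ≤ ‖P (A y + S y)‖ + L * L * t * ‖Q y‖ ∧
    m / 2 * ‖Q y‖ ≤ ‖Q (A y + S y)‖ + 2 * L * L / |c| * ‖P (A y + S y)‖ := by
  obtain ⟨α, hα⟩ := h.exists_smul y
  have hc' : 0 < |c| := abs_pos.2 hc
  have hPy : ‖P y‖ = |α| := by rw [hα, norm_smul, h.norm_eq_one, mul_one, Real.norm_eq_abs]
  have hy : y = α • v + Q y := by rw [← hα, h.add_apply]
  have hSy : S y = α • S v + S (Q y) := by
    conv_lhs => rw [hy]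
    simp
  have h1 : t * (|c| / 2) * ‖P y‖ ≤ ‖P (A y + S y)‖ + L * L * t * ‖Q y‖ := by
    have hid : (α * (t * c)) • v =
        P (A y + S y) - P (S (Q y)) - α • (P (S v) - (t * c) • v) := by
      rw [map_add, hPA, hSy, map_add, map_smul]; module
    have hn : |α| * (t * |c|) ≤
        ‖P (A y + S y)‖ + L * (L * t * ‖Q y‖) + |α| * (|c| / 2 * t) := by
      calc |α| * (t * |c|) = ‖(α * (t * c)) • v‖ := by
            rw [norm_smul, h.norm_eq_one, Real.norm_eq_abs, abs_mul, abs_mul, abs_of_pos ht,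
              mul_one]
        _ ≤ ‖P (A y + S y)‖ + ‖P (S (Q y))‖ + ‖α • (P (S v) - (t * c) • v)‖ := by
            rw [hid]
            exact (norm_sub_le _ _).trans (add_le_add_left (norm_sub_le _ _) _)
        _ ≤ _ := by
            rw [norm_smul, Real.norm_eq_abs]
            gcongr
            exact (hP _).trans (by gcongr; exact hS _)
    rw [hPy]; linarith
  refine ⟨h1, ?_⟩
  -- the range of `A` lies in that of `Q`, so `A` drops out of `P` and is intact in `Q`
  have hQA : Q (A y) = A y := by simpa [hPA] using h.add_apply (A y)
  have hid : A y = Q (A y + S y) - Q (S y) := by rw [map_add, hQA]; abel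
  have hyn : ‖y‖ ≤ ‖P y‖ + ‖Q y‖ := by
    conv_lhs => rw [← h.add_apply y]
    exact norm_add_le _ _
  have h2 : m * ‖Q y‖ ≤ ‖Q (A y + S y)‖ + L * L * t * (‖P y‖ + ‖Q y‖) := by
    calc m * ‖Q y‖ ≤ ‖A y‖ := hm y
      _ ≤ ‖Q (A y + S y)‖ + ‖Q (S y)‖ := by
          conv_lhs => rw [hid]
          exact norm_sub_le _ _
      _ ≤ ‖Q (A y + S y)‖ + L * (L * t * (‖P y‖ + ‖Q y‖)) := by
          gcongr
          exact (hQ _).trans (by gcongr; exact (hS _).trans (by gcongr))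
      _ = _ := by ring
  have h3 : L * L * t * ‖P y‖ ≤ 2 * L * L / |c| * (‖P (A y + S y)‖ + L * L * t * ‖Q y‖) := by
    calc L * L * t * ‖P y‖ = 2 * L * L / |c| * (t * (|c| / 2) * ‖P y‖) := by field_simp
      _ ≤ _ := by gcongr
  have h4 := mul_le_mul_of_nonneg_right hsmall (norm_nonneg (Q y))
  linarith

/-- The linearization error at `e = t v + h`: since half of `t v` solves the Newton equation up to
terms that vanish with `h`, the residual of `(t / 2) v` is quadratic, with a small constant in the
`P` component. -/
lemma residual_bounds {n : ℕ} {P Q G Om : Eu n →L[ℝ] Eu n} {v : Eu n}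
    (h : LineSplitting P Q v) {B : Eu n →L[ℝ] Eu n →L[ℝ] Eu n} {L t c δ Δ : ℝ} {e om g : Eu n}
    (hL : 1 ≤ L) (ht : 0 < t) (ht1 : t ≤ 1) (hδ : 0 ≤ δ) (hδ1 : δ ≤ 1) (hΔ : 0 ≤ Δ)
    (hP : ∀ y, ‖P y‖ ≤ L * ‖y‖) (hQ : ∀ y, ‖Q y‖ ≤ L * ‖y‖)
    (hB : ∀ a b, ‖B a b‖ ≤ L * ‖a‖ * ‖b‖) (hc : P (B v v) = c • v)
    (he : ‖e‖ = t) (hcone : ‖e - t • v‖ ≤ δ * t)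
    (hG : ∀ y, ‖G y‖ ≤ L * t ^ 2 * ‖y‖) (hOm : ∀ y, ‖Om y‖ ≤ L * t * ‖y‖)
    (hPOm : ∀ y, ‖P (Om y)‖ ≤ Δ * t * ‖y‖) (hom : ‖om‖ ≤ L * t ^ 2)
    (hPom : ‖P om‖ ≤ L * (t * ‖Q e‖ + t ^ 3)) (hg : ‖g‖ ≤ L * t ^ 3) :
    (∀ y, ‖(B e + G + Om) y‖ ≤ 3 * L * t * ‖y‖) ∧
    ‖P ((B e + G + Om) v) - (t * c) • v‖ ≤ (4 * L ^ 2 * (δ + t) + 2 * Δ) * t ∧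
    ‖(1 / 2 : ℝ) • B e e + G e + Om e + om - g - (t / 2) • (B e + G + Om) v‖ ≤ 6 * L * t ^ 2 ∧
    ‖P ((1 / 2 : ℝ) • B e e + G e + Om e + om - g - (t / 2) • (B e + G + Om) v)‖ ≤
      (4 * L ^ 2 * (δ + t) + 2 * Δ) * t ^ 2 := by
  set d := e - t • v with hd
  have hv := h.norm_eq_one
  have hed : e = t • v + d := by rw [hd]; abel
  have hdt : ‖d‖ ≤ t := hcone.trans (by nlinarith)
  have hL0 : 0 ≤ L := by linarith
  have hLL : L ≤ L ^ 2 := by nlinarith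
  set a : Eu n := (t / 2) • v + d with ha
  have han : ‖a‖ ≤ 3 / 2 * t := by
    calc ‖a‖ ≤ ‖(t / 2) • v‖ + ‖d‖ := norm_add_le _ _
      _ ≤ t / 2 + t := by
          rw [norm_smul, hv, Real.norm_eq_abs, abs_of_pos (by positivity), mul_one]; gcongr
      _ = _ := by ring
  have hQe : ‖Q e‖ ≤ L * (δ * t) := by
    rw [hed, map_add, map_smul, h.right_apply, smul_zero, zero_add]
    exact (hQ _).trans (by gcongr)
  have htt : t ^ 3 ≤ t ^ 2 := pow_le_pow_of_le_one ht.le ht1 (by norm_num)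
  have htt' : t ^ 2 ≤ t := by nlinarith
  have hT : (1 / 2 : ℝ) • B e e + G e + Om e + om - g - (t / 2) • (B e + G + Om) v =
      (1 / 2 : ℝ) • B e d + G a + Om a + om - g := by
    have hea : e = (t / 2) • v + a := by rw [ha, hed]; module
    have e1 : B e e = t • B e v + B e d := by
      conv_lhs => enter [2]; rw [hed]
      simp
    have e2 : G e = (t / 2) • G v + G a := by
      conv_lhs => rw [hea]
      simp
    have e3 : Om e = (t / 2) • Om v + Om a := by
      conv_lhs => rw [hea]
      simp
    rw [e1, e2, e3]
    simp only [_root_.add_apply]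
    module
  have hBd : ‖B e d‖ ≤ L * t * (δ * t) := (hB _ _).trans (by rw [he]; gcongr)
  have hGa : ‖G a‖ ≤ L * t ^ 2 * (3 / 2 * t) := (hG _).trans (by gcongr)
  have hOa : ‖Om a‖ ≤ L * t * (3 / 2 * t) := (hOm _).trans (by gcongr)
  have hPOa : ‖P (Om a)‖ ≤ Δ * t * (3 / 2 * t) := (hPOm _).trans (by gcongr)
  refine ⟨fun y => ?_, ?_, ?_, ?_⟩
  · simp only [_root_.add_apply]
    have := hB e y
    rw [he] at this
    have h2 := hG y
    have h3 := hOm y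
    have h4 : L * t ^ 2 * ‖y‖ ≤ L * t * ‖y‖ := by gcongr
    have := norm_add₃_le (a := B e y) (b := G y) (c := Om y)
    linarith
  · have hid : P ((B e + G + Om) v) - (t * c) • v = P (B d v) + P (G v) + P (Om v) := by
      have : B e v = t • B v v + B d v := by
        conv_lhs => rw [hed]
        simp
      simp only [_root_.add_apply, map_add, this, map_smul, hc]
      module
    have h1 : ‖P (B d v)‖ ≤ L * (L * (δ * t)) :=
      (hP _).trans (by gcongr; exact (hB _ _).trans (by rw [hv, mul_one]; gcongr))
    have h2 : ‖P (G v)‖ ≤ L * (L * t ^ 2) :=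
      (hP _).trans (by gcongr; exact (hG _).trans (by rw [hv, mul_one]))
    have h3 : ‖P (Om v)‖ ≤ Δ * t := (hPOm _).trans (by rw [hv, mul_one])
    rw [hid]
    have := norm_add₃_le (a := P (B d v)) (b := P (G v)) (c := P (Om v))
    have p1 : 0 ≤ L ^ 2 * (δ * t) := by positivity
    have p2 : 0 ≤ L ^ 2 * t ^ 2 := by positivity
    have p3 : 0 ≤ Δ * t := by positivity
    linarith
  · rw [hT]
    have h1 : ‖(1 / 2 : ℝ) • B e d‖ ≤ 1 / 2 * (L * t ^ 2) := by
      rw [norm_smul, Real.norm_of_nonneg (by norm_num)]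
      gcongr
      calc _ ≤ L * t * (δ * t) := hBd
        _ ≤ L * t * (1 * t) := by gcongr
        _ = _ := by ring
    have hLt : L * t ^ 3 ≤ L * t ^ 2 := by gcongr
    have hLt0 : 0 ≤ L * t ^ 2 := by positivity
    have := norm_sub_le ((1 / 2 : ℝ) • B e d + G a + Om a + om) g
    have := norm_add_le ((1 / 2 : ℝ) • B e d + G a + Om a) om
    have := norm_add₃_le (a := (1 / 2 : ℝ) • B e d) (b := G a) (c := Om a)
    linarith
  · rw [hT]
    simp only [map_add, map_sub, map_smul]
    have h1 : ‖(1 / 2 : ℝ) • P (B e d)‖ ≤ 1 / 2 * (L * (L * t * (δ * t))) := by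
      rw [norm_smul, Real.norm_of_nonneg (by norm_num)]
      gcongr
      exact (hP _).trans (by gcongr)
    have h2 : ‖P (G a)‖ ≤ L * (L * t ^ 2 * (3 / 2 * t)) := (hP _).trans (by gcongr)
    have h3 : ‖P g‖ ≤ L * (L * t ^ 3) := (hP _).trans (by gcongr)
    have h4 : ‖P om‖ ≤ L * (t * (L * (δ * t)) + t ^ 3) := hPom.trans (by gcongr)
    have := norm_sub_le ((1 / 2 : ℝ) • P (B e d) + P (G a) + P (Om a) + P om) (P g)
    have := norm_add_le ((1 / 2 : ℝ) • P (B e d) + P (G a) + P (Om a)) (P om)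
    have := norm_add₃_le (a := (1 / 2 : ℝ) • P (B e d)) (b := P (G a)) (c := P (Om a))
    have p1 : 0 ≤ L ^ 2 * (δ * t ^ 2) := by positivity
    have p2 : L * t ^ 3 ≤ L ^ 2 * t ^ 3 := by gcongr
    have p3 : 0 ≤ Δ * t ^ 2 := by positivity
    have p4 : 0 ≤ L ^ 2 * t ^ 3 := by positivity
    linarith

/-! ### Uniform estimates and starlike domains -/

/-- Uniform estimates in `j` for `x → xs`, in terms of a radius. -/
lemma bound_of_isBigO {E ι : Type*} [SeminormedAddCommGroup E] {n : ℕ} {xs : Eu n}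
    {F : ι × Eu n → E} {g : Eu n → ℝ} (hg : ∀ x, 0 ≤ g x)
    (h : F =O[⊤ ×ˢ 𝓝[≠] xs] fun p => g p.2) :
    ∃ K > (0 : ℝ), ∃ ρ > (0 : ℝ), ∀ j x, x ≠ xs → ‖x - xs‖ < ρ → ‖F (j, x)‖ ≤ K * g x := by
  obtain ⟨K, hK, hb⟩ := h.exists_pos
  rw [isBigOWith_iff, eventually_prod_iff] at hb
  obtain ⟨p, hp, q, hq, hpq⟩ := hb
  rw [eventually_top] at hp
  rw [eventually_nhdsWithin_iff, Metric.eventually_nhds_iff] at hq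
  obtain ⟨ρ, hρ, hq⟩ := hq
  refine ⟨K, hK, ρ, hρ, fun j x hne hx => ?_⟩
  have := hpq (hp j) (hq (by rwa [dist_eq_norm]) hne)
  rwa [Real.norm_of_nonneg (hg _)] at this

lemma norm_sub_smul_lt_of_mem_starlikeDomain {n : ℕ} {xs v x : Eu n} {ε δ : ℝ}
    (hx : x ∈ starlikeDomain xs v ε δ) :
    0 < ‖x - xs‖ ∧ ‖x - xs‖ < ε ∧ ‖(x - xs) - ‖x - xs‖ • v‖ < δ * ‖x - xs‖ := by
  obtain ⟨h0, h1, h2⟩ := hx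
  have ht : 0 < ‖x - xs‖ := norm_pos_iff.2 (sub_ne_zero.2 h0)
  refine ⟨ht, h1, ?_⟩
  have : (x - xs) - ‖x - xs‖ • v = ‖x - xs‖ • (‖x - xs‖⁻¹ • (x - xs) - v) := by
    rw [smul_sub, smul_smul, mul_inv_cancel₀ ht.ne', one_smul]
  rw [this, norm_smul, norm_norm, mul_comm]
  gcongr

lemma mem_starlikeDomain_of_norm_sub_smul_lt {n : ℕ} {xs v x : Eu n} {ε δ : ℝ}
    (h0 : 0 < ‖x - xs‖) (h1 : ‖x - xs‖ < ε) (h2 : ‖(x - xs) - ‖x - xs‖ • v‖ < δ * ‖x - xs‖) :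
    x ∈ starlikeDomain xs v ε δ := by
  refine ⟨sub_ne_zero.1 (norm_pos_iff.1 h0), h1, ?_⟩
  have : (x - xs) - ‖x - xs‖ • v = ‖x - xs‖ • (‖x - xs‖⁻¹ • (x - xs) - v) := by
    rw [smul_sub, smul_smul, mul_inv_cancel₀ h0.ne', one_smul]
  rw [this, norm_smul, norm_norm, mul_comm] at h2
  exact lt_of_mul_lt_mul_right h2 h0.le

lemma starlikeDomain_mono {n : ℕ} {xs v : Eu n} {ε ε' δ δ' : ℝ} (h : ε ≤ ε') (h' : δ ≤ δ') :
    starlikeDomain xs v ε δ ⊆ starlikeDomain xs v ε' δ' :=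
  fun _ hx => ⟨hx.1, hx.2.1.trans_le h, hx.2.2.trans_le h'⟩

/-! ### The Newton image near the axis -/

set_option maxHeartbeats 600000 in
/-- The Newton image `x + w` of a point near the axis: with error `s ‖x - xs‖` it is the midpoint
of `xs` and the point of the axis at distance `‖x - xs‖`, and its `Q` component is quadratic with
a constant that does not depend on `s`. -/
lemma newton_estimate {n : ℕ} {ι : Type*} {f : Eu n → Eu n} {xs v : Eu n}
    {Ω : ι → Eu n → (Eu n →L[ℝ] Eu n)} {ω : ι → Eu n → Eu n} {P Q : Eu n →L[ℝ] Eu n} {m c : ℝ}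
    (h : LineSplitting P Q v) (hroot : f xs = 0) (hC2 : ContDiff ℝ 2 f)
    (hLip : (fun x => secondDeriv f x - secondDeriv f xs) =O[𝓝 xs] (fun x => ‖x - xs‖))
    (hPA : ∀ y, P (fderiv ℝ f xs y) = 0) (hAv : fderiv ℝ f xs v = 0)
    (hm0 : 0 < m) (hm : ∀ y, m * ‖Q y‖ ≤ ‖fderiv ℝ f xs y‖)
    (hc0 : c ≠ 0) (hc : P (secondDeriv f xs v v) = c • v)
    (hpert : PerturbationEstimates xs v P Q Ω ω) :
    ∃ C > (0 : ℝ), ∀ s > (0 : ℝ), ∃ ε > (0 : ℝ), ∃ δ > (0 : ℝ), ∀ j,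
      ∀ x ∈ starlikeDomain xs v ε δ,
        (fderiv ℝ f x + Ω j x).IsInvertible ∧
        ‖Q (x - xs + (fderiv ℝ f x + Ω j x).inverse (-f x + ω j x))‖ ≤ C * ‖x - xs‖ ^ 2 ∧
        ‖x - xs + (fderiv ℝ f x + Ω j x).inverse (-f x + ω j x) - (‖x - xs‖ / 2) • v‖ ≤
          s * ‖x - xs‖ := by
  set A := fderiv ℝ f xs with hA
  set B := secondDeriv f xs with hB
  obtain ⟨K₁, hK₁, ρ₁, hρ₁, hT⟩ := taylor_bounds hC2 hLip
  obtain ⟨K₂, hK₂, ρ₂, hρ₂, hOm⟩ := bound_of_isBigO (fun x => norm_nonneg (x - xs))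
    hpert.Omega_bigO
  obtain ⟨K₃, hK₃, ρ₃, hρ₃, hom⟩ := bound_of_isBigO (g := fun x => ‖x - xs‖ ^ 2)
    (fun x => by positivity) hpert.omega_bigO
  obtain ⟨K₄, hK₄, ρ₄, hρ₄, hPom⟩ := bound_of_isBigO
    (g := fun x => ‖x - xs‖ * ‖Q (x - xs)‖ + ‖x - xs‖ ^ 3)
    (fun x => by positivity) hpert.PN_omega_bigO
  -- a single constant above all those in the estimates
  set L := 1 + K₁ + K₂ + K₃ + K₄ + 3 * ‖P‖ + 3 * ‖Q‖ + ‖B‖ with hL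
  have nP := norm_nonneg P
  have nQ := norm_nonneg Q
  have nB := norm_nonneg B
  have hL1 : 1 ≤ L := by linarith
  have hP : ∀ y, ‖P y‖ ≤ L * ‖y‖ := fun y => P.le_of_opNorm_le (by linarith) y
  have hQ : ∀ y, ‖Q y‖ ≤ L * ‖y‖ := fun y => Q.le_of_opNorm_le (by linarith) y
  have hBL : ∀ a b, ‖B a b‖ ≤ L * ‖a‖ * ‖b‖ := fun a b =>
    (B.le_opNorm₂ a b).trans (by gcongr; linarith)
  have hc' : 0 < |c| := abs_pos.2 hc0
  -- the constants of `singular_perturbation_bounds`, applied with `3 * L` in place of `L`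
  set D := 2 * (3 * L) * (3 * L) / |c| with hD
  have hD0 : 0 < D := by positivity
  set C := 2 / m * (L * (6 * L) + D * (6 * L ^ 2)) with hC
  have hC0 : 0 < C := by positivity
  clear_value L D C
  refine ⟨C, hC0, fun s hs => ?_⟩
  -- `ρ` bounds the relative size of the error in the `P` component
  set ρ := min (|c| / 2) (s * |c| / 8) with hρ
  have hρ0 : 0 < ρ := by positivity
  have hρ1 : ρ ≤ |c| / 2 := min_le_left _ _
  have hρ2 : ρ ≤ s * |c| / 8 := min_le_right _ _
  clear_value ρ
  obtain ⟨ε₅, hε₅, δ₅, hδ₅, hPOm⟩ := hpert.PN_Omega_small (ρ / 4) (by positivity)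
  set ε := min (min (min ρ₁ ρ₂) (min ρ₃ ρ₄)) (min (min 1 ε₅) (min (ρ / (16 * L ^ 2))
    (min (m / 2 / ((3 * L) * (3 * L) * (1 + D))) (min (s / (2 * C))
      (s * |c| / (8 * ((3 * L) * (3 * L)) * C)))))) with hε
  have hε0 : 0 < ε := by positivity
  set δ := min (min 1 δ₅) (ρ / (16 * L ^ 2)) with hδ
  have hδ0 : 0 < δ := by positivity
  refine ⟨ε, hε0, δ, hδ0, fun j x hx => ?_⟩
  obtain ⟨ht, htε, hcone⟩ := norm_sub_smul_lt_of_mem_starlikeDomain hx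
  set e := x - xs with he
  set t := ‖e‖ with hte
  simp only [hε, lt_min_iff] at htε
  obtain ⟨⟨⟨t1, t2⟩, ⟨t3, t4⟩⟩, ⟨t5, t6⟩, t7, t8, t9, t10⟩ := htε
  have hδ5 : δ ≤ δ₅ := (min_le_left _ _).trans (min_le_right _ _)
  have hδ1 : δ ≤ 1 := (min_le_left _ _).trans (min_le_left _ _)
  have hδρ : δ ≤ ρ / (16 * L ^ 2) := min_le_right _ _
  clear_value δ ε
  have hPOmj := hPOm j x ⟨hx.1, t6, hx.2.2.trans_le hδ5⟩
  obtain ⟨hT1, hT2⟩ := hT x t1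
  rw [hroot, sub_zero] at hT2
  rw [← he] at hT1 hT2 hPOmj
  set G := fderiv ℝ f x - A - B e with hG
  set g := f x - A e - (1 / 2 : ℝ) • B e e with hg
  have hOmj : ‖Ω j x‖ ≤ K₂ * t := hOm j x hx.1 t2
  have homj : ‖ω j x‖ ≤ K₃ * t ^ 2 := hom j x hx.1 t3
  have hPomj : ‖P (ω j x)‖ ≤ K₄ * (t * ‖Q e‖ + t ^ 3) := hPom j x hx.1 t4
  obtain ⟨r1, r2, r3, r4⟩ := residual_bounds (G := G) (Om := Ω j x) (om := ω j x) (g := g)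
    (δ := δ) (Δ := ρ / 4) h hL1 ht t5.le hδ0.le hδ1 (by positivity) hP hQ hBL hc rfl hcone.le
    (fun y => G.le_of_opNorm_le (hT1.trans (by gcongr; linarith)) y)
    (fun y => (Ω j x).le_of_opNorm_le (hOmj.trans (by gcongr; linarith)) y)
    (fun y => (P ∘L Ω j x).le_of_opNorm_le hPOmj y)
    (homj.trans (by gcongr; linarith)) (hPomj.trans (by gcongr; linarith))
    (hT2.trans (by gcongr; linarith))
  set S := B e + G + Ω j x with hS
  have hJ : fderiv ℝ f x + Ω j x = A + S := by rw [hS, hG]; abel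
  have hρb : 4 * L ^ 2 * (δ + t) + 2 * (ρ / 4) ≤ ρ := by
    have h1 : δ + t ≤ ρ / (8 * L ^ 2) := by
      have : ρ / (8 * L ^ 2) = ρ / (16 * L ^ 2) + ρ / (16 * L ^ 2) := by field_simp; norm_num
      linarith
    have h2 : 4 * L ^ 2 * (δ + t) ≤ 4 * L ^ 2 * (ρ / (8 * L ^ 2)) := by gcongr
    have h3 : 4 * L ^ 2 * (ρ / (8 * L ^ 2)) = ρ / 2 := by field_simp; norm_num
    linarith
  have key := singular_perturbation_bounds (S := S) (L := 3 * L) (m := m) (t := t) (c := c) h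
    (by linarith) hc0 ht (fun y => (hP y).trans (by gcongr; linarith))
    (fun y => (hQ y).trans (by gcongr; linarith)) hPA hm r1
    (r2.trans (by gcongr; exact hρb.trans hρ1)) (by
      rw [lt_div_iff₀ (by positivity)] at t8
      rw [← hD]; linarith)
  have hinv : (fderiv ℝ f x + Ω j x).IsInvertible := by
    rw [hJ]
    have hinj : Function.Injective (A + S : Eu n →L[ℝ] Eu n).toLinearMap := by
      rw [← LinearMap.ker_eq_bot, LinearMap.ker_eq_bot']
      intro y hy
      have hy' : A y + S y = 0 := hy
      obtain ⟨k1, k2⟩ := key y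
      rw [hy', map_zero, map_zero, norm_zero, mul_zero, add_zero, ← mul_zero (m / 2)] at k2
      have hQy : ‖Q y‖ = 0 :=
        le_antisymm (le_of_mul_le_mul_left k2 (by positivity)) (norm_nonneg _)
      rw [hy', map_zero, norm_zero, hQy, mul_zero, add_zero, ← mul_zero (t * (|c| / 2))] at k1
      have hPy : ‖P y‖ = 0 :=
        le_antisymm (le_of_mul_le_mul_left k1 (by positivity)) (norm_nonneg _)
      rw [← h.add_apply y, norm_eq_zero.1 hQy, norm_eq_zero.1 hPy, add_zero]
    exact ⟨(LinearEquiv.ofInjectiveEndo _ hinj).toContinuousLinearEquiv, by ext; rfl⟩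
  refine ⟨hinv, ?_⟩
  set w := (fderiv ℝ f x + Ω j x).inverse (-f x + ω j x) with hw
  have hJw : A w + S w = -f x + ω j x := by
    have := hinv.self_apply_inverse (-f x + ω j x)
    rw [← hw, hJ] at this
    exact this
  set y := e + w - (t / 2) • v with hy
  have hyT : A y + S y =
      (1 / 2 : ℝ) • B e e + G e + Ω j x e + ω j x - g - (t / 2) • S v := by
    have h1 : A y + S y = A e + S e + (A w + S w) - (t / 2) • (A v + S v) := by
      simp only [hy, map_add, map_sub, map_smul]; module
    rw [h1, hJw, hAv, hg]
    simp only [hS, _root_.add_apply]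
    module
  obtain ⟨k1, k2⟩ := key y
  rw [hyT] at k1 k2
  have hQT := (hQ _).trans (mul_le_mul_of_nonneg_left r3 (by linarith : (0 : ℝ) ≤ L))
  have hPT := (hP _).trans (mul_le_mul_of_nonneg_left r3 (by linarith : (0 : ℝ) ≤ L))
  have hQy : ‖Q y‖ ≤ C * t ^ 2 := by
    have h1 : m / 2 * ‖Q y‖ ≤ L * (6 * L * t ^ 2) + D * (L * (6 * L * t ^ 2)) :=
      k2.trans (by rw [← hD]; gcongr)
    have h2 : C * t ^ 2 = 2 / m * (L * (6 * L * t ^ 2) + D * (L * (6 * L * t ^ 2))) := by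
      rw [hC]; ring
    rw [h2]
    calc ‖Q y‖ = 2 / m * (m / 2 * ‖Q y‖) := by field_simp
      _ ≤ _ := by gcongr
  constructor
  · have : Q (e + w) = Q y := by
      rw [hy, map_sub, map_smul, h.right_apply, smul_zero, sub_zero]
    rw [this]; exact hQy
  · have hPy : ‖P y‖ ≤ s / 2 * t := by
      have h1 : t * (|c| / 2) * ‖P y‖ ≤ s * |c| / 8 * t ^ 2 + 3 * L * (3 * L) * t * (C * t ^ 2) :=
        k1.trans (by
          gcongr
          exact r4.trans (by gcongr; exact hρb.trans hρ2))
      have h2 : 3 * L * (3 * L) * t * (C * t ^ 2) ≤ s * |c| / 8 * t ^ 2 := by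
        rw [lt_div_iff₀ (by positivity)] at t10
        have : 3 * L * (3 * L) * C * t ≤ s * |c| / 8 := by linarith
        calc _ = 3 * L * (3 * L) * C * t * t ^ 2 := by ring
          _ ≤ _ := by gcongr
      have h3 : t * (|c| / 2) * ‖P y‖ ≤ t * (|c| / 2) * (s / 2 * t) := by linarith
      exact le_of_mul_le_mul_left h3 (by positivity)
    have hQy' : C * t ^ 2 ≤ s / 2 * t := by
      rw [lt_div_iff₀ (by positivity)] at t9
      calc C * t ^ 2 = t * (2 * C) / 2 * t := by ring
        _ ≤ s / 2 * t := by gcongr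
    calc ‖y‖ = ‖P y + Q y‖ := by rw [h.add_apply]
      _ ≤ ‖P y‖ + ‖Q y‖ := norm_add_le _ _
      _ ≤ _ := by linarith

/-! ### Anderson steps near the axis -/

/-- Asymptotics of the Newton data at distance `t` near the axis: `u` is the Newton image relative
to the root, `w` the update step. -/
structure NewtonData {n : ℕ} (Q : Eu n →L[ℝ] Eu n) (v : Eu n) (C s t : ℝ) (u w : Eu n) :
    Prop where
  pos : 0 < t
  right : ‖Q u‖ ≤ C * t ^ 2
  image : ‖u - (t / 2) • v‖ ≤ s * t
  step : ‖w + (t / 2) • v‖ ≤ s * t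

lemma NewtonData.norm_step {n : ℕ} {Q : Eu n →L[ℝ] Eu n} {v u w : Eu n} {C s t : ℝ}
    (h : NewtonData Q v C s t u w) (hv : ‖v‖ = 1) :
    (1 / 2 - s) * t ≤ ‖w‖ ∧ ‖w‖ ≤ (1 / 2 + s) * t := by
  have h1 : ‖(t / 2) • v‖ = t / 2 := by
    rw [norm_smul, hv, mul_one, Real.norm_of_nonneg (by linarith [h.pos])]
  have h2 := h.step
  have h3 : ‖(t / 2) • v‖ ≤ ‖w + (t / 2) • v‖ + ‖w‖ := by
    simpa using norm_sub_le (w + (t / 2) • v) w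
  have h4 : ‖w‖ ≤ ‖w + (t / 2) • v‖ + ‖(t / 2) • v‖ := by
    simpa using norm_sub_le (w + (t / 2) • v) ((t / 2) • v)
  constructor <;> linarith

/-- One Anderson step from the Newton data at two consecutive iterates. The safeguard enters through
the two bounds on `|c|`: relative to `1 - c`, the older data are never larger than the newer ones, so
that all errors are small relative to `(1 - c) t'`, a quantity comparable to the combined update. -/
lemma anderson_step {n : ℕ} {P Q : Eu n →L[ℝ] Eu n} {v u u' w w' : Eu n} {C s t t' c r M : ℝ}
    (h : LineSplitting P Q v) (hM : 1 ≤ M) (hP : ∀ y, ‖P y‖ ≤ M * ‖y‖)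
    (hr0 : 0 < r) (hr1 : r < 1) (hs : 0 < s) (hs' : 4096 * M * s ≤ 1 - r) (hC : 0 < C)
    (hd : NewtonData Q v C s t u w) (hd' : NewtonData Q v C s t' u' w') (hc : 0 < 1 - c)
    (hc1 : |c| * ‖w‖ ≤ r * (1 - c) * ‖w'‖) (hc2 : |c| * ‖w‖ ^ 2 ≤ (1 - c) * ‖w'‖ ^ 2) :
    ‖Q ((1 - c) • u' + c • u)‖ ≤ 5 * C * (1 - c) * t' ^ 2 ∧
    (∃ α : ℝ, (1 - c) * (1 - r) * t' / 8 ≤ α ∧ P ((1 - c) • u' + c • u) = α • v) ∧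
    ‖(1 - c) • u' + c • u‖ ≤ 5 / 8 * gain c w' w * t' := by
  have ht := hd.pos
  have ht' := hd'.pos
  obtain ⟨a1, a2⟩ := hd.norm_step h.norm_eq_one
  obtain ⟨b1, b2⟩ := hd'.norm_step h.norm_eq_one
  have hMs : s ≤ M * s := le_mul_of_one_le_left hs.le hM
  have hs1 : 4096 * s ≤ 1 - r := by linarith
  have hs2 : 4096 * s ≤ 1 := by linarith
  have hw' : t' / 4 ≤ ‖w'‖ := le_trans (by nlinarith) b1
  have hac := abs_nonneg c
  -- `w`, `w'` have norms close to `t / 2`, `t' / 2`, so the bounds on `|c|` carry over to `t`, `t'`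
  have q1 : |c| * t ≤ (1 - c) * ((1 + r) / 2) * t' := by
    have e1 : (1 / 2 - s) * (|c| * t) ≤ r * (1 - c) * ((1 / 2 + s) * t') := by
      calc (1 / 2 - s) * (|c| * t) = |c| * ((1 / 2 - s) * t) := by ring
        _ ≤ |c| * ‖w‖ := by gcongr
        _ ≤ r * (1 - c) * ‖w'‖ := hc1
        _ ≤ _ := by gcongr
    have e2 : r * (1 / 2 + s) ≤ (1 / 2 - s) * ((1 + r) / 2) := by nlinarith
    have e3 : r * (1 - c) * ((1 / 2 + s) * t') ≤
        (1 / 2 - s) * ((1 - c) * ((1 + r) / 2) * t') := by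
      calc _ = (1 - c) * t' * (r * (1 / 2 + s)) := by ring
        _ ≤ (1 - c) * t' * ((1 / 2 - s) * ((1 + r) / 2)) := by gcongr
        _ = _ := by ring
    exact le_of_mul_le_mul_left (e1.trans e3) (by linarith)
  have q1' : |c| * t ≤ (1 - c) * t' := q1.trans (by gcongr; nlinarith)
  have q2 : |c| * t ^ 2 ≤ 4 * ((1 - c) * t' ^ 2) := by
    have e1 : (1 / 2 - s) ^ 2 * (|c| * t ^ 2) ≤ (1 / 2 + s) ^ 2 * ((1 - c) * t' ^ 2) := by
      have : 0 ≤ (1 / 2 - s) * t := mul_nonneg (by linarith) ht.le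
      calc (1 / 2 - s) ^ 2 * (|c| * t ^ 2) = |c| * ((1 / 2 - s) * t) ^ 2 := by ring
        _ ≤ |c| * ‖w‖ ^ 2 := by gcongr
        _ ≤ (1 - c) * ‖w'‖ ^ 2 := hc2
        _ ≤ (1 - c) * ((1 / 2 + s) * t') ^ 2 := by gcongr
        _ = _ := by ring
    have e2 : (1 / 2 + s) ^ 2 ≤ (1 / 2 - s) ^ 2 * 4 := by nlinarith
    have e3 : (1 / 2 - s) ^ 2 * (|c| * t ^ 2) ≤ (1 / 2 - s) ^ 2 * (4 * ((1 - c) * t' ^ 2)) := by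
      calc _ ≤ (1 / 2 + s) ^ 2 * ((1 - c) * t' ^ 2) := e1
        _ ≤ (1 / 2 - s) ^ 2 * 4 * ((1 - c) * t' ^ 2) := by gcongr
        _ = _ := by ring
    have : 0 < 1 / 2 - s := by linarith
    exact le_of_mul_le_mul_left e3 (by positivity)
  have comb : ∀ a b : Eu n, ‖(1 - c) • a + c • b‖ ≤ (1 - c) * ‖a‖ + |c| * ‖b‖ := fun a b => by
    refine (norm_add_le _ _).trans (le_of_eq ?_)
    rw [norm_smul, norm_smul, Real.norm_of_nonneg hc.le, Real.norm_eq_abs]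
  refine ⟨?_, ?_, ?_⟩
  · rw [map_add, map_smul, map_smul]
    calc _ ≤ (1 - c) * ‖Q u'‖ + |c| * ‖Q u‖ := comb _ _
      _ ≤ (1 - c) * (C * t' ^ 2) + |c| * (C * t ^ 2) := by
          gcongr
          exacts [hd'.right, hd.right]
      _ = (1 - c) * (C * t' ^ 2) + C * (|c| * t ^ 2) := by ring
      _ ≤ (1 - c) * (C * t' ^ 2) + C * (4 * ((1 - c) * t' ^ 2)) := by gcongr
      _ = _ := by ring
  · obtain ⟨α, hα⟩ := h.exists_smul ((1 - c) • u' + c • u)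
    refine ⟨α, ?_, hα⟩
    -- `τ` is the coordinate of the unperturbed new error
    set τ := ((1 - c) * t' + c * t) / 2 with hτ
    have e1 : (α - τ) • v =
        P ((1 - c) • (u' - (t' / 2) • v) + c • (u - (t / 2) • v)) := by
      have : (1 - c) • (u' - (t' / 2) • v) + c • (u - (t / 2) • v) =
          ((1 - c) • u' + c • u) - τ • v := by rw [hτ]; module
      rw [this, map_sub, hα, map_smul, h.left_apply, sub_smul]
    have e2 : |α - τ| ≤ M * (2 * (s * ((1 - c) * t'))) := by
      calc |α - τ| = ‖(α - τ) • v‖ := by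
            rw [norm_smul, h.norm_eq_one, mul_one, Real.norm_eq_abs]
        _ ≤ M * ((1 - c) * (s * t') + |c| * (s * t)) := by
            rw [e1]
            refine (hP _).trans ?_
            gcongr
            refine (comb _ _).trans ?_
            gcongr
            exacts [hd'.image, hd.image]
        _ = M * (s * ((1 - c) * t') + s * (|c| * t)) := by ring
        _ ≤ M * (s * ((1 - c) * t') + s * ((1 - c) * t')) := by gcongr
        _ = _ := by ring
    have e3 : (1 - c) * t' * (1 - r) / 4 ≤ τ := by
      have : -(|c| * t) ≤ c * t := by
        rw [← neg_mul]; gcongr; exact neg_abs_le c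
      rw [hτ]; linarith
    have e4 : M * (2 * (s * ((1 - c) * t'))) ≤ (1 - c) * t' * (1 - r) / 8 := by
      have : 0 < (1 - c) * t' := by positivity
      nlinarith
    have := (abs_le.1 (e2.trans e4)).1
    linarith
  -- `W` is the combined step; `u + w` is small since `u ≈ (t / 2) v ≈ -w`
  · set W := w' - c • (w' - w) with hW
    have hWd : W = (1 - c) • w' + c • w := by rw [hW]; module
    have hgain : ‖W‖ = gain c w' w * ‖w'‖ := by
      have : ‖w'‖ ≠ 0 := by linarith
      rw [gain, ← hW]; field_simp
    have e1 : (1 - c) * (1 - r) * (t' / 4) ≤ ‖W‖ := by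
      have : (1 - c) * ‖w'‖ ≤ ‖W‖ + |c| * ‖w‖ := by
        have : ‖(1 - c) • w'‖ ≤ ‖W‖ + ‖c • w‖ := by
          have := norm_sub_le W (c • w)
          rwa [hWd, add_sub_cancel_right, ← hWd] at this
        rwa [norm_smul, norm_smul, Real.norm_of_nonneg hc.le, Real.norm_eq_abs] at this
      calc (1 - c) * (1 - r) * (t' / 4) ≤ (1 - c) * (1 - r) * ‖w'‖ := by
            have : 0 < 1 - r := by linarith
            gcongr
        _ ≤ ‖W‖ := by linarith
    have f : ∀ {a b : Eu n} {t : ℝ}, NewtonData Q v C s t a b → ‖a + b‖ ≤ 2 * s * t :=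
      fun {a b t} hab => by
        have : a + b = (a - (t / 2) • v) + (b + (t / 2) • v) := by abel
        rw [this]
        refine (norm_add_le _ _).trans ?_
        linarith [hab.image, hab.step]
    have e2 : ‖((1 - c) • u' + c • u) + W‖ ≤ 4 * s * ((1 - c) * t') := by
      have : ((1 - c) • u' + c • u) + W = (1 - c) • (u' + w') + c • (u + w) := by
        rw [hWd]; module
      rw [this]
      calc _ ≤ (1 - c) * ‖u' + w'‖ + |c| * ‖u + w‖ := comb _ _
        _ ≤ (1 - c) * (2 * s * t') + |c| * (2 * s * t) := by
            gcongr
            exacts [f hd', f hd]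
        _ = 2 * s * ((1 - c) * t') + 2 * s * (|c| * t) := by ring
        _ ≤ 2 * s * ((1 - c) * t') + 2 * s * ((1 - c) * t') := by gcongr
        _ = _ := by ring
    have e3 : 4 * s * ((1 - c) * t') ≤ 1 / 16 * ‖W‖ := by
      have : 0 < (1 - c) * t' := by positivity
      nlinarith
    have e4 : ‖(1 - c) • u' + c • u‖ ≤ 17 / 16 * ‖W‖ := by
      have := norm_sub_le (((1 - c) • u' + c • u) + W) W
      rw [add_sub_cancel_right] at this
      linarith
    have hg0 : 0 ≤ gain c w' w := by unfold gain; positivity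
    calc _ ≤ 17 / 16 * (gain c w' w * ‖w'‖) := by rw [← hgain]; exact e4
      _ ≤ 17 / 16 * (gain c w' w * ((1 / 2 + s) * t')) := by gcongr
      _ = (17 / 16 * (1 / 2 + s)) * (gain c w' w * t') := by ring
      _ ≤ 5 / 8 * (gain c w' w * t') := by gcongr; linarith
      _ = _ := by ring

/-- A vector whose `Q` component is much smaller than its positive coordinate along `v` points
almost in the direction of `v`. -/
lemma cone_of_right_small {n : ℕ} {P Q : Eu n →L[ℝ] Eu n} {v e : Eu n} {α δ : ℝ}
    (h : LineSplitting P Q v) (hδ : 0 < δ) (hδ1 : δ ≤ 1) (hα : 0 < α) (he : P e = α • v)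
    (hQ : ‖Q e‖ ≤ δ / 4 * α) : 0 < ‖e‖ ∧ ‖e - ‖e‖ • v‖ < δ * ‖e‖ := by
  have hαv : ‖α • v‖ = α := by rw [norm_smul, h.norm_eq_one, mul_one, Real.norm_of_nonneg hα.le]
  have hd : e - α • v = Q e := by
    conv_lhs => enter [1]; rw [← h.add_apply e]
    rw [he]; abel
  have h1 : |‖e‖ - α| ≤ ‖Q e‖ := by
    rw [← hd]
    conv_lhs => rw [← hαv]
    exact abs_norm_sub_norm_le _ _
  have h2 : ‖e - ‖e‖ • v‖ ≤ 2 * ‖Q e‖ := by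
    have : e - ‖e‖ • v = Q e - (‖e‖ - α) • v := by rw [← hd]; module
    rw [this]
    refine (norm_sub_le _ _).trans ?_
    rw [norm_smul, h.norm_eq_one, mul_one, Real.norm_eq_abs]
    linarith
  have h3 := (abs_le.1 h1).1
  have hδα : δ * α ≤ 1 * α := by gcongr
  have h4 : 3 / 4 * α ≤ ‖e‖ := by linarith
  refine ⟨by linarith, h2.trans_lt ?_⟩
  have : δ * (3 / 4 * α) ≤ δ * ‖e‖ := by gcongr
  have : 0 < δ * α := by positivity
  linarith

/-- The cone around `v` is invariant under an Anderson step from a point within distance `ε ≪ δ`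
of the root, and the `P` component contracts with the gain of the step. -/
lemma anderson_step_mem_cone {n : ℕ} {P Q : Eu n →L[ℝ] Eu n} {v u u' w w' e : Eu n}
    {C s t c r M ε δ : ℝ} (h : LineSplitting P Q v) (hM : 1 ≤ M) (hP : ∀ y, ‖P y‖ ≤ M * ‖y‖)
    (hQ : ∀ y, ‖Q y‖ ≤ M * ‖y‖) (hr0 : 0 < r) (hr1 : r < 1) (hs : 0 < s)
    (hs' : 4096 * M * s ≤ 1 - r) (hC : 0 < C) (hδ : 0 < δ) (hδ1 : δ ≤ 1) (hδs : δ ≤ s)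
    (hε : 160 * C * ε ≤ δ * (1 - r))
    (hd : NewtonData Q v C s t u w) (hd' : NewtonData Q v C s ‖e‖ u' w')
    (heε : ‖e‖ < ε) (hcone : ‖e - ‖e‖ • v‖ < δ * ‖e‖) (hc : 0 < 1 - c)
    (hc1 : |c| * ‖w‖ ≤ r * (1 - c) * ‖w'‖) (hc2 : |c| * ‖w‖ ^ 2 ≤ (1 - c) * ‖w'‖ ^ 2)
    (hgain : gain c w' w ≤ 1) {e'' : Eu n} (he'' : e'' = (1 - c) • u' + c • u) :
    0 < ‖e''‖ ∧ ‖e''‖ ≤ 3 / 4 * ‖e‖ ∧ ‖e'' - ‖e''‖ • v‖ < δ * ‖e''‖ ∧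
    ‖P e''‖ ≤ 3 / 4 * gain c w' w * ‖P e‖ := by
  obtain ⟨k1, ⟨α, k2, k3⟩, k4⟩ := anderson_step h hM hP hr0 hr1 hs hs' hC hd hd' hc hc1 hc2
  rw [← he''] at k1 k3 k4
  have ht := hd'.pos
  set t' := ‖e‖ with ht'
  have hr : 0 < 1 - r := by linarith
  have hε0 : 0 < ε := ht.trans heε
  have hα : 0 < α := lt_of_lt_of_le (by positivity) k2
  have hQe : ‖Q e''‖ ≤ δ / 4 * α := by
    have e1 : 5 * C * (1 - c) * t' ^ 2 * (1 - r) ≤ 40 * C * ε * α := by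
      calc 5 * C * (1 - c) * t' ^ 2 * (1 - r) = 40 * C * t' * ((1 - c) * (1 - r) * t' / 8) := by
            ring
        _ ≤ 40 * C * ε * α := by gcongr
    have e2 : 40 * C * ε * α ≤ δ / 4 * α * (1 - r) := by
      calc 40 * C * ε * α = 160 * C * ε * (α / 4) := by ring
        _ ≤ δ * (1 - r) * (α / 4) := by gcongr
        _ = _ := by ring
    exact k1.trans (le_of_mul_le_mul_right (e1.trans e2) hr)
  obtain ⟨p1, p2⟩ := cone_of_right_small h hδ hδ1 hα k3 hQe
  have hg0 : 0 ≤ gain c w' w := by unfold gain; positivity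
  refine ⟨p1, ?_, p2, ?_⟩
  · have : gain c w' w * t' ≤ 1 * t' := by gcongr
    linarith
  · have hMδ : M * δ ≤ 1 / 4096 := by
      have : M * δ ≤ M * s := by gcongr
      linarith
    have hQc : ∀ y : Eu n, ‖y - ‖y‖ • v‖ < δ * ‖y‖ → ‖Q y‖ ≤ 1 / 4096 * ‖y‖ := by
      intro y hy
      have : Q y = Q (y - ‖y‖ • v) := by
        rw [map_sub, map_smul, h.right_apply, smul_zero, sub_zero]
      rw [this]
      calc _ ≤ M * ‖y - ‖y‖ • v‖ := hQ _
        _ ≤ M * (δ * ‖y‖) := by gcongr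
        _ = M * δ * ‖y‖ := by ring
        _ ≤ _ := by gcongr
    have f1 : ‖P e''‖ ≤ (1 + 1 / 4096) * ‖e''‖ := by
      have : P e'' = e'' - Q e'' := by
        conv_rhs => enter [1]; rw [← h.add_apply e'']
        abel
      rw [this]
      linarith [norm_sub_le e'' (Q e''), hQc _ p2]
    have f2 : t' ≤ ‖P e‖ + 1 / 4096 * t' := by
      have := norm_add_le (P e) (Q e)
      rw [h.add_apply] at this
      linarith [hQc _ hcone]
    have f3 : (1 + 1 / 4096) * (5 / 8) * t' ≤ 3 / 4 * ‖P e‖ := by linarith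
    calc ‖P e''‖ ≤ (1 + 1 / 4096) * (5 / 8 * gain c w' w * t') := f1.trans (by gcongr)
      _ = gain c w' w * ((1 + 1 / 4096) * (5 / 8) * t') := by ring
      _ ≤ gain c w' w * (3 / 4 * ‖P e‖) := by gcongr
      _ = _ := by ring

/-! ### Convergence of the safeguarded method -/

/-- A linear map is bounded below on a complement of its kernel. -/
lemma exists_pos_mul_norm_projAlong_le {n : ℕ} {A : Eu n →L[ℝ] Eu n} {p q : Submodule ℝ (Eu n)}
    (hp : p = LinearMap.ker (A : Eu n →ₗ[ℝ] Eu n)) (h : IsCompl q p) :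
    ∃ m > (0 : ℝ), ∀ y, m * ‖projAlong q p h y‖ ≤ ‖A y‖ := by
  have hker : LinearMap.ker ((A : Eu n →ₗ[ℝ] Eu n).domRestrict q) = ⊥ := by
    rw [LinearMap.ker_eq_bot']
    intro z hz
    have : (z : Eu n) ∈ p := by rw [hp]; exact hz
    exact Subtype.ext ((Submodule.disjoint_def.1 h.disjoint) z z.2 this)
  obtain ⟨K, hK, hanti⟩ := LinearMap.exists_antilipschitzWith _ hker
  refine ⟨(K : ℝ)⁻¹, by positivity, fun y => ?_⟩
  have h1 : projAlong q p h y ∈ q := Submodule.projection_apply_mem h y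
  have h2 : y - projAlong q p h y ∈ p := Submodule.sub_projection_mem h y
  have h3 : A y = A (projAlong q p h y) := by
    have : A (y - projAlong q p h y) = 0 := by
      exact LinearMap.mem_ker.1 (hp.le h2)
    rwa [map_sub, sub_eq_zero] at this
  have h4 := hanti.le_mul_dist ⟨_, h1⟩ 0
  rw [dist_zero_right, map_zero, dist_zero_right] at h4
  have h5 : ‖projAlong q p h y‖ ≤ K * ‖A y‖ := by rw [h3]; exact h4
  have hK' : (0 : ℝ) < K := hK
  rwa [inv_mul_le_iff₀ hK']

theorem mainTheorem1 {n : ℕ} {ι : Type*} (f : Eu n → Eu n) (xs v : Eu n)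
    (Ω : ι → Eu n → (Eu n →L[ℝ] Eu n)) (ω : ι → Eu n → Eu n) (r : ℝ)
    (hr : r ∈ Set.Ioo (0 : ℝ) 1)
    (hroot : f xs = 0)
    (hC2 : ContDiff ℝ 2 f)
    (hLip : (fun x => secondDeriv f x - secondDeriv f xs) =O[𝓝 xs] (fun x => ‖x - xs‖))
    (hv : ‖v‖ = 1)
    (hN : nullSp f xs = Submodule.span ℝ {v})
    (hNR : IsCompl (nullSp f xs) (rangeSp f xs))
    (hreg : TwoRegularAt f xs v hNR)
    (hpert : PerturbationEstimates xs v
      (projAlong (nullSp f xs) (rangeSp f xs) hNR)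
      (projAlong (rangeSp f xs) (nullSp f xs) hNR.symm) Ω ω) :
    ∃ C > (0 : ℝ), ∃ κ ∈ Set.Ioo (0 : ℝ) 1, ∃ δ₀ > (0 : ℝ), ∀ δ ∈ Set.Ioo (0 : ℝ) δ₀,
      ∃ ε₀ > (0 : ℝ), ∀ ε ∈ Set.Ioo (0 : ℝ) ε₀,
        ∀ (i : ℕ → ι) (x w : ℕ → Eu n), IsSafeguardedPNM f Ω ω r i x w →
          x 0 ∈ starlikeDomain xs v ε δ →
          (∀ k, (fderiv ℝ f (x k) + Ω (i k) (x k)).IsInvertible) ∧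
          (∀ k, 1 ≤ k → w k ≠ 0 ∧ w (k + 1) ≠ w k) ∧
          (∀ k, x k ∈ starlikeDomain xs v ε δ) ∧
          Tendsto x atTop (𝓝 xs) ∧
          (∀ k, 1 ≤ k →
            ‖projAlong (rangeSp f xs) (nullSp f xs) hNR.symm (x (k + 1) - xs)‖ ≤
              C * max (‖x k - xs‖ ^ 2) (‖x (k - 1) - xs‖ ^ 2)) ∧
          (∀ k, 1 ≤ k →
            ‖projAlong (nullSp f xs) (rangeSp f xs) hNR (x (k + 1) - xs)‖ ≤
              κ * gain (safeguardedCoeff r (w (k + 1)) (w k)) (w (k + 1)) (w k) *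
                ‖projAlong (nullSp f xs) (rangeSp f xs) hNR (x k - xs)‖) := by
  obtain ⟨m, hm0, hm⟩ := exists_pos_mul_norm_projAlong_le (A := fderiv ℝ f xs) rfl hNR.symm
  change ∀ y, m * ‖projAlong (rangeSp f xs) (nullSp f xs) hNR.symm y‖ ≤ _ at hm
  set P := projAlong (nullSp f xs) (rangeSp f xs) hNR with hPdef
  set Q := projAlong (rangeSp f xs) (nullSp f xs) hNR.symm with hQdef
  have hvN : v ∈ nullSp f xs := by rw [hN]; exact Submodule.mem_span_singleton_self v
  have hmem : ∀ y, P y ∈ nullSp f xs := fun y => Submodule.projection_apply_mem hNR y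
  have hsplit : LineSplitting P Q v := by
    refine ⟨hv, fun y => Submodule.projection_add_projection_eq_self hNR y, fun y => ?_,
      (Submodule.projection_apply_eq_zero_iff hNR.symm).2 hvN⟩
    have := hmem y
    rw [hN, Submodule.mem_span_singleton] at this
    obtain ⟨α, hα⟩ := this
    exact ⟨α, hα.symm⟩
  have hPA : ∀ y, P (fderiv ℝ f xs y) = 0 := fun y =>
    (Submodule.projection_apply_eq_zero_iff hNR).2 ⟨y, rfl⟩
  have hAv : fderiv ℝ f xs v = 0 := hvN
  obtain ⟨c₀, hc₀⟩ := hsplit.exists_smul (secondDeriv f xs v v)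
  -- 2-regularity along `v` says that the scalar `c₀` is nonzero
  have hc₀' : c₀ ≠ 0 := by
    rintro rfl
    have h0 : v = 0 := hreg.injOn hvN (Submodule.zero_mem _) (by
      change fderiv ℝ f xs v + P (secondDeriv f xs v (P v)) =
        fderiv ℝ f xs 0 + P (secondDeriv f xs v (P 0))
      rw [hsplit.left_apply, hc₀, hAv]; simp)
    simp [h0] at hv
  obtain ⟨C, hC, hnewton⟩ :=
    newton_estimate hsplit hroot hC2 hLip hPA hAv hm0 hm hc₀' hc₀ hpert
  set M := 1 + ‖P‖ + ‖Q‖ with hM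
  have hM1 : 1 ≤ M := by linarith [norm_nonneg P, norm_nonneg Q]
  have hPM : ∀ y, ‖P y‖ ≤ M * ‖y‖ := fun y => P.le_of_opNorm_le (by linarith [norm_nonneg Q]) y
  have hQM : ∀ y, ‖Q y‖ ≤ M * ‖y‖ := fun y => Q.le_of_opNorm_le (by linarith [norm_nonneg P]) y
  clear_value M
  obtain ⟨hr0, hr1⟩ := hr
  have hr' : 0 < 1 - r := by linarith
  set s := (1 - r) / (4096 * M) with hs
  have hs0 : 0 < s := by positivity
  have hMs : 4096 * M * s ≤ 1 - r := by rw [hs]; apply le_of_eq; field_simp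
  clear_value s
  have hs1 : 4096 * s ≤ 1 := by nlinarith
  obtain ⟨ε₁, hε₁, δ₁, hδ₁, hnewton⟩ := hnewton (s / 2) (by positivity)
  refine ⟨5 * C / (1 - r), by positivity, 3 / 4, by norm_num, min δ₁ (s / 2), by positivity,
    fun δ hδ => ⟨min ε₁ (δ * (1 - r) / (160 * C)), ?_, ?_⟩⟩
  · have := hδ.1
    positivity
  intro ε hε i x w hx hx0
  obtain ⟨hδ0, hδ'⟩ := hδ
  rw [lt_min_iff] at hδ'
  obtain ⟨hε0, hε'⟩ := hε
  rw [lt_min_iff, lt_div_iff₀ (by positivity)] at hε'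
  have hεδ : 160 * C * ε ≤ δ * (1 - r) := by linarith [hε'.2]
  have hnext : ∀ k, x k ∈ starlikeDomain xs v ε δ →
      NewtonData Q v C s ‖x k - xs‖ (x k - xs + w (k + 1)) (w (k + 1)) ∧
        (fderiv ℝ f (x k) + Ω (i k) (x k)).IsInvertible := by
    intro k hk
    obtain ⟨h1, h2, h3⟩ := hnewton (i k) (x k) (starlikeDomain_mono hε'.1.le hδ'.1.le hk)
    rw [← hx.update k] at h2 h3
    obtain ⟨t0, t1, t2⟩ := norm_sub_smul_lt_of_mem_starlikeDomain hk
    have t3 : δ * ‖x k - xs‖ ≤ s / 2 * ‖x k - xs‖ := by gcongr; exact hδ'.2.le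
    refine ⟨⟨t0, h2, by linarith [mul_pos hs0 t0], ?_⟩, h1⟩
    have : w (k + 1) + (‖x k - xs‖ / 2) • v = (x k - xs + w (k + 1) - (‖x k - xs‖ / 2) • v) -
        (x k - xs - ‖x k - xs‖ • v) := by module
    rw [this]
    refine (norm_sub_le _ _).trans ?_
    linarith
  -- the contraction factor `3 / 4` makes the update steps strictly decreasing
  have hwlt : ∀ k, x k ∈ starlikeDomain xs v ε δ → x (k + 1) ∈ starlikeDomain xs v ε δ →
      ‖x (k + 1) - xs‖ ≤ 3 / 4 * ‖x k - xs‖ → 0 < ‖w (k + 1)‖ ∧ ‖w (k + 2)‖ < ‖w (k + 1)‖ := by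
    intro k h0 h1 h
    have t0 := (hnext k h0).1.pos
    obtain ⟨a1, a2⟩ := (hnext k h0).1.norm_step hv
    obtain ⟨b1, b2⟩ := (hnext _ h1).1.norm_step hv
    have : (1 / 2 + s) * ‖x (k + 1) - xs‖ ≤ (1 / 2 + s) * (3 / 4 * ‖x k - xs‖) := by gcongr
    have : 4096 * s * ‖x k - xs‖ ≤ 1 * ‖x k - xs‖ := by gcongr
    constructor <;> linarith
  have herr : ∀ k, x (k + 2) - xs =
      (1 - safeguardedCoeff r (w (k + 2)) (w (k + 1))) • (x (k + 1) - xs + w (k + 2)) +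
      safeguardedCoeff r (w (k + 2)) (w (k + 1)) • (x k - xs + w (k + 1)) := by
    intro k
    rw [hx.step (k + 1) (by omega), Nat.add_sub_cancel]
    module
  have hstep : ∀ k, x k ∈ starlikeDomain xs v ε δ → x (k + 1) ∈ starlikeDomain xs v ε δ →
      ‖x (k + 1) - xs‖ ≤ 3 / 4 * ‖x k - xs‖ →
      x (k + 2) ∈ starlikeDomain xs v ε δ ∧ ‖x (k + 2) - xs‖ ≤ 3 / 4 * ‖x (k + 1) - xs‖ ∧
      ‖Q (x (k + 2) - xs)‖ ≤ 5 * C / (1 - r) * ‖x (k + 1) - xs‖ ^ 2 ∧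
      ‖P (x (k + 2) - xs)‖ ≤ 3 / 4 *
        gain (safeguardedCoeff r (w (k + 2)) (w (k + 1))) (w (k + 2)) (w (k + 1)) *
          ‖P (x (k + 1) - xs)‖ := by
    intro k h0 h1 h
    obtain ⟨w0, w1⟩ := hwlt k h0 h1 h
    obtain ⟨c1, c2, c3, c4, c5⟩ := safeguardedCoeff_bounds ⟨hr0, hr1⟩ w0 w1.le
    obtain ⟨t0, t1, t2⟩ := norm_sub_smul_lt_of_mem_starlikeDomain h1
    obtain ⟨p1, p2, p3, p4⟩ := anderson_step_mem_cone hsplit hM1 hPM hQM hr0 hr1 hs0 hMs hC hδ0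
      (by linarith) (by linarith) hεδ (hnext k h0).1 (hnext (k + 1) h1).1 t1 t2 c1 c3 c4 c5
      (herr k)
    obtain ⟨q1, -, -⟩ := anderson_step hsplit hM1 hPM hr0 hr1 hs0 hMs hC (hnext k h0).1
      (hnext (k + 1) h1).1 c1 c3 c4
    refine ⟨mem_starlikeDomain_of_norm_sub_smul_lt p1 (by linarith) p3, p2, ?_, p4⟩
    rw [herr k]
    refine q1.trans ?_
    have hc : 1 - safeguardedCoeff r (w (k + 2)) (w (k + 1)) ≤ 1 / (1 - r) := by
      rw [le_div_iff₀ hr']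
      linarith [neg_le_abs (safeguardedCoeff r (w (k + 2)) (w (k + 1)))]
    calc _ ≤ 5 * C * (1 / (1 - r)) * ‖x (k + 1) - xs‖ ^ 2 := by gcongr
      _ = _ := by ring
  have hall : ∀ k, x k ∈ starlikeDomain xs v ε δ ∧ x (k + 1) ∈ starlikeDomain xs v ε δ ∧
      ‖x (k + 1) - xs‖ ≤ 3 / 4 * ‖x k - xs‖ := by
    intro k
    induction k with
    | zero =>
      -- the unaccelerated first step is an Anderson step with coefficient `0`
      obtain ⟨t0, t1, t2⟩ := norm_sub_smul_lt_of_mem_starlikeDomain hx0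
      have hd := (hnext 0 hx0).1
      have hg : gain 0 (w (0 + 1)) (w (0 + 1)) ≤ 1 := by
        rw [gain, zero_smul, sub_zero]; exact div_self_le_one _
      obtain ⟨p1, p2, p3, -⟩ := anderson_step_mem_cone (c := 0) (e'' := x 1 - xs) hsplit hM1 hPM
        hQM hr0 hr1 hs0 hMs hC hδ0 (by linarith) (by linarith) hεδ hd hd t1 t2 (by norm_num)
        (by rw [abs_zero, zero_mul]; positivity) (by rw [abs_zero, zero_mul]; positivity) hg
        (by rw [hx.first]; module)
      exact ⟨hx0, mem_starlikeDomain_of_norm_sub_smul_lt p1 (by linarith) p3, p2⟩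
    | succ k ih =>
      obtain ⟨h1, h2, -⟩ := hstep k ih.1 ih.2.1 ih.2.2
      exact ⟨ih.2.1, h1, h2⟩
  refine ⟨fun k => (hnext k (hall k).1).2, ?_, fun k => (hall k).1, ?_, ?_, ?_⟩
  · intro k hk
    obtain ⟨k, rfl⟩ := Nat.exists_eq_add_of_le' hk
    obtain ⟨a, b⟩ := hwlt k (hall k).1 (hall k).2.1 (hall k).2.2
    exact ⟨norm_pos_iff.1 a, fun heq => b.ne (by rw [← heq])⟩
  · rw [tendsto_iff_norm_sub_tendsto_zero]
    have hgeo : ∀ k, ‖x k - xs‖ ≤ (3 / 4 : ℝ) ^ k * ‖x 0 - xs‖ := by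
      intro k
      induction k with
      | zero => simp
      | succ k ih => rw [pow_succ]; linarith [(hall k).2.2]
    have hlim : Tendsto (fun k => (3 / 4 : ℝ) ^ k * ‖x 0 - xs‖) atTop (𝓝 0) := by
      simpa using (tendsto_pow_atTop_nhds_zero_of_lt_one (r := (3 / 4 : ℝ)) (by norm_num)
        (by norm_num)).mul_const ‖x 0 - xs‖
    exact squeeze_zero (fun k => norm_nonneg _) hgeo hlim
  · intro k hk
    obtain ⟨k, rfl⟩ := Nat.exists_eq_add_of_le' hk
    refine (hstep k (hall k).1 (hall k).2.1 (hall k).2.2).2.2.1.trans ?_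
    gcongr
    exact le_max_left _ _
  · intro k hk
    obtain ⟨k, rfl⟩ := Nat.exists_eq_add_of_le' hk
    exact (hstep k (hall k).1 (hall k).2.1 (hall k).2.2).2.2.2
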